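/- Let $\mathbb F$ be an algebraically closed field of characteristic zero, $G$ a finite group, and $A=\bigoplus_{g\in G}A_g$ a $G$-graded associative $\mathbb F$-algebra (not necessarily unital). Assume that the grading is regular with commutation function $\theta$, that is: 1. for every $n\ge 1$, every $(g_1,\dots,g_n)\in G^n$ and every $\sigma\in \mathrm{Sym}(n)$ with $g_1\cdots g_n=g_{\sigma(1)}\cdots g_{\sigma(n)}$ there is a scalar $\theta_{((g_1,\dots,g_n),\sigma)}\in\mathbb F^\times$ such that $a_1\cdots a_n=\theta_{((g_1,\dots,g_n),\sigma)}\,a_{\sigma(1)}\cdots a_{\sigma(n)}$ for all $a_i\in A_{g_i}$; 2. for every $n\ge 1$ and every $(g_1,\dots,g_n)\in G^n$ there are $a_i\in A_{g_i}$ with $a_1\cdots a_n\neq 0$. For commuting $g,h\in G$ write $\theta_{g,h}=\theta_{((g,h),(1\,2))}$, and put $\psi(g)=\theta_{g,g}\in\{\pm1\}$. Let $\tau$ be the commutation function of the infinite-dimensional Grassmann algebra with its $\{\pm1\}$-grading (the even part has degree $1$, the odd part degree $-1$): on pairs, $\tau_{-1,-1}=-1$ and $\tau_{1,1}=\tau_{1,-1}=\tau_{-1,1}=1$;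 on tuples, $\tau_{((s_1,\dots,s_n),\sigma)}$ is the product of $\tau_{s_{\sigma(i)},s_{\sigma(j)}}$ over all $i<j$ with $\sigma(i)>\sigma(j)$. For a $2$-cocycle $\alpha:G\times G\to\mathbb F^\times$ (trivial action) let $\mathbb F^\alpha G$ be the twisted group algebra, with basis $(U_g)_{g\in G}$ and multiplication $U_gU_h=\alpha(g,h)U_{gh}$, graded by the components $\mathbb F U_g$. Say that $\alpha$ corresponds to $\theta$ if the commutation function of $\mathbb F^\alpha G$ is $\tau\theta$, i.e. its value at $((g_1,\dots,g_n),\sigma)$ is $\tau_{((\psi(g_1),\dots,\psi(g_n)),\sigma)}\,\theta_{((g_1,\dots,g_n),\sigma)}$ whenever $g_1\cdots g_n=g_{\sigma(1)}\cdots g_{\sigma(n)}$. The commutation matrix $M^A\in M_{|G|}(\mathbb F^\alpha G)$ is then defined by $$(M^A)_{g,h}=\tau_{\psi(g),\psi(h)}\,U_gU_hU_g^{-1}U_h^{-1}\qquad(g,h\in G).$$ Suppose that the grading is degenerate: there is $g\ne e$ in $G$ such that $\theta_{g,h}=1$ for all $h$ in the centralizer $C_G(g)$. Then a $2$-cocycle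 $\alpha$ corresponding to $\theta$ exists, and for every such $\alpha$ the commutation matrix $M^A$ is not invertible in $M_{|G|}(\mathbb F^\alpha G)$. -/

import Mathlib

/-! ### Regular gradings by arbitrary groups -/

/-- The product `a₁ a₂ ⋯ aₙ` of a nonempty tuple; no unit element is needed. -/
def tupleProd {S : Type*} [Mul S] : {n : ℕ} → (Fin (n + 1) → S) → S
  | 0, a => a 0
  | _ + 1, a => a 0 * tupleProd (fun i => a i.succ)

theorem tupleProd_eq_prod_ofFn {S : Type*} [Monoid S] {n : ℕ} (a : Fin (n + 1) → S) :
    tupleProd a = (List.ofFn a).prod := by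
  induction n with
  | zero => simp [tupleProd]
  | succ n ih => rw [tupleProd, ih, List.ofFn_succ (f := a), List.prod_cons]

/-- `σ ∈ Sym(g₁, …, gₙ)`: the products `g₁ ⋯ gₙ` and `g_{σ(1)} ⋯ g_{σ(n)}` agree. -/
def FixesProduct {G : Type*} [Group G] {n : ℕ} (g : Fin (n + 1) → G)
    (σ : Equiv.Perm (Fin (n + 1))) : Prop :=
  tupleProd g = tupleProd (g ∘ σ)

/-- A `G`-grading on a (not necessarily unital) associative algebra `A`: a vector space decomposition
`A = ⨁ A_g` such that `A_g A_h ⊆ A_{gh}`. -/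
structure IsGroupGrading {F G A : Type*} [Field F] [Group G] [DecidableEq G] [NonUnitalRing A]
    [Module F A] (𝒜 : G → Submodule F A) : Prop where
  isInternal : DirectSum.IsInternal 𝒜
  mul_mem : ∀ {g h : G} {a b : A}, a ∈ 𝒜 g → b ∈ 𝒜 h → a * b ∈ 𝒜 (g * h)

/-- Functions assigning a nonzero scalar to every nonempty tuple `(g₁, …, gₙ)` and every permutation
`σ`. Only the values with `σ ∈ Sym(g₁, …, gₙ)` are relevant. -/
abbrev ScalarFamily (G F : Type*) [Field F] : Type _ :=
  (n : ℕ) → (Fin (n + 1) → G) → Equiv.Perm (Fin (n + 1)) → Fˣ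

/-- The commutation condition: `a₁ ⋯ aₙ = θ_{(g, σ)} a_{σ(1)} ⋯ a_{σ(n)}` for all `aᵢ ∈ A_{gᵢ}`
and all `σ ∈ Sym(g₁, …, gₙ)`. -/
def HasCommutation {F G A : Type*} [Field F] [Group G] [NonUnitalRing A] [Module F A]
    (𝒜 : G → Submodule F A) (θ : ScalarFamily G F) : Prop :=
  ∀ (n : ℕ) (g : Fin (n + 1) → G) (σ : Equiv.Perm (Fin (n + 1))), FixesProduct g σ →
    ∀ a : Fin (n + 1) → A, (∀ i, a i ∈ 𝒜 (g i)) →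
      tupleProd a = (θ n g σ : F) • tupleProd (a ∘ σ)

/-- `𝒜` is a regular `G`-grading on `A` with commutation function `θ`. The relevant values of `θ`
are determined by `𝒜`. -/
structure IsRegularGrading {F G A : Type*} [Field F] [Group G] [DecidableEq G] [NonUnitalRing A]
    [Module F A] (𝒜 : G → Submodule F A) (θ : ScalarFamily G F) : Prop where
  isGroupGrading : IsGroupGrading 𝒜
  hasCommutation : HasCommutation 𝒜 θ
  exists_ne_zero : ∀ (n : ℕ) (g : Fin (n + 1) → G),
    ∃ a : Fin (n + 1) → A, (∀ i, a i ∈ 𝒜 (g i)) ∧ tupleProd a ≠ 0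

namespace ScalarFamily

variable {G F : Type*} [Field F]

/-- `θ_{g,h} = θ_{((g,h),(1 2))}`, for commuting `g` and `h`. -/
def pair (θ : ScalarFamily G F) (g h : G) : Fˣ :=
  θ 1 ![g, h] (Equiv.swap 0 1)

/-- `ψ(g) = θ_{g,g}`. -/
def diag (θ : ScalarFamily G F) (g : G) : Fˣ :=
  θ.pair g g

/-- For every `g ≠ e` there is `h ∈ C_G(g)` with `θ_{g,h} ≠ 1`. -/
def Nondegenerate [Group G] (θ : ScalarFamily G F) : Prop :=
  ∀ g : G, g ≠ 1 → ∃ h ∈ Subgroup.centralizer {g}, θ.pair g h ≠ 1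

end ScalarFamily

/-! ### The commutation function of the Grassmann algebra -/

open Classical in
/-- `τ` on pairs of `C₂ = {1, -1}`: `τ(-1, -1) = -1`, and `τ` is `1` on all other pairs. -/
noncomputable def grassmannPair {F : Type*} [Field F] (s t : Fˣ) : Fˣ :=
  if s = -1 ∧ t = -1 then -1 else 1

/-- `τ` on tuples: reordering homogeneous elements of the Grassmann algebra of parities
`s₁, …, sₙ` by `σ` costs the factor `τ` of the exchanged parities at every inversion of `σ`. -/
noncomputable def grassmannTuple {F : Type*} [Field F] {n : ℕ} (s : Fin (n + 1) → Fˣ)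
    (σ : Equiv.Perm (Fin (n + 1))) : Fˣ :=
  ∏ i : Fin (n + 1), ∏ j : Fin (n + 1),
    if i < j ∧ σ j < σ i then grassmannPair (s (σ i)) (s (σ j)) else 1

/-- The family `τθ`, where `τ` is applied to the parities `ψ(gᵢ) = θ_{gᵢ,gᵢ}`. -/
noncomputable def ScalarFamily.grassmannTwist {G F : Type*} [Field F] (θ : ScalarFamily G F) :
    ScalarFamily G F :=
  fun n g σ => grassmannTuple (fun i => θ.diag (g i)) σ * θ n g σ

/-! ### Twisted group algebras -/

/-- 2-cocycles on `G` with values in `Fˣ` (trivial action), not necessarily normalized. -/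
structure TwoCocycle (G F : Type*) [Group G] [Field F] where
  toFun : G → G → Fˣ
  cocycle : ∀ g h k : G, toFun g h * toFun (g * h) k = toFun g (h * k) * toFun h k

/-- The twisted group algebra `F^α G`: the vector space with basis `(U_g)` and the
multiplication `U_g U_h = α(g,h) U_{gh}`. -/
def TwistedGroupAlgebra {G F : Type*} [Group G] [Field F] (_α : TwoCocycle G F) : Type _ :=
  G →₀ F

namespace TwistedGroupAlgebra

variable {G F : Type*} [Group G] [Field F] (α : TwoCocycle G F)

noncomputable instance : AddCommGroup (TwistedGroupAlgebra α) :=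
  inferInstanceAs (AddCommGroup (G →₀ F))

noncomputable instance : Module F (TwistedGroupAlgebra α) :=
  inferInstanceAs (Module F (G →₀ F))

/-- The basis element `U_g`. -/
noncomputable def basisElt (g : G) : TwistedGroupAlgebra α :=
  (Finsupp.single g 1 : G →₀ F)

/-- Linear maps on the twisted group algebra, given by their values on the basis. -/
noncomputable def lift {V : Type*} [AddCommGroup V] [Module F V] (f : G → V) :
    TwistedGroupAlgebra α →ₗ[F] V :=
  Finsupp.linearCombination F f

@[simp]
theorem lift_basisElt {V : Type*} [AddCommGroup V] [Module F V] (f : G → V) (g : G) :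
    lift α f (basisElt α g) = f g := by
  have h := Finsupp.linearCombination_single F (v := f) (1 : F) g
  rw [one_smul] at h
  exact h

theorem hom_ext {V : Type*} [AddCommGroup V] [Module F V] {f f' : TwistedGroupAlgebra α →ₗ[F] V}
    (h : ∀ g, f (basisElt α g) = f' (basisElt α g)) : f = f' :=
  Finsupp.lhom_ext' (M := F) (R := F) (N := V) (φ := f) (ψ := f')
    (fun g => LinearMap.ext_ring (h g))

/-- The multiplication as a bilinear map. -/
noncomputable def mulMap :
    TwistedGroupAlgebra α →ₗ[F] TwistedGroupAlgebra α →ₗ[F] TwistedGroupAlgebra α :=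
  lift α fun g => lift α fun h => (α.toFun g h : F) • basisElt α (g * h)

noncomputable instance : Mul (TwistedGroupAlgebra α) := ⟨fun x y => mulMap α x y⟩

noncomputable instance : One (TwistedGroupAlgebra α) :=
  ⟨(((α.toFun 1 1)⁻¹ : Fˣ) : F) • basisElt α 1⟩

theorem mul_def (x y : TwistedGroupAlgebra α) : x * y = mulMap α x y := rfl

theorem one_def : (1 : TwistedGroupAlgebra α) = (((α.toFun 1 1)⁻¹ : Fˣ) : F) • basisElt α 1 := rfl

theorem basisElt_mul (g h : G) :
    basisElt α g * basisElt α h = (α.toFun g h : F) • basisElt α (g * h) := by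
  simp [mul_def, mulMap]

theorem toFun_one_left (g : G) : α.toFun 1 g = α.toFun 1 1 := by
  have h := α.cocycle 1 1 g
  simp only [one_mul] at h
  exact (mul_right_cancel h).symm

theorem toFun_one_right (g : G) : α.toFun g 1 = α.toFun 1 1 := by
  have h := α.cocycle g 1 1
  simp only [mul_one] at h
  exact mul_left_cancel h

theorem smul_mul' (c : F) (x y : TwistedGroupAlgebra α) : (c • x) * y = c • (x * y) := by
  simp [mul_def]

theorem mul_smul' (c : F) (x y : TwistedGroupAlgebra α) : x * (c • y) = c • (x * y) := by
  simp [mul_def]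

theorem mul_assoc' (x y z : TwistedGroupAlgebra α) : x * y * z = x * (y * z) := by
  have key : (mulMap α).compr₂ (mulMap α) =
      ((LinearMap.llcomp F _ _ _).flip (mulMap α)).comp
        ((LinearMap.llcomp F _ _ _).comp (mulMap α)) := by
    refine hom_ext α fun g => hom_ext α fun h => hom_ext α fun k => ?_
    change basisElt α g * basisElt α h * basisElt α k =
      basisElt α g * (basisElt α h * basisElt α k)
    simp only [basisElt_mul, smul_mul', mul_smul', smul_smul, mul_assoc]
    congr 1
    have := congrArg (Units.val) (α.cocycle g h k)
    push_cast at this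
    rw [this, mul_comm]
  exact congrArg (fun f => f x y z) key

theorem one_mul' (x : TwistedGroupAlgebra α) : 1 * x = x := by
  have key : mulMap α 1 = LinearMap.id := by
    refine hom_ext α fun g => ?_
    change 1 * basisElt α g = basisElt α g
    rw [one_def, smul_mul', basisElt_mul, smul_smul, toFun_one_left α g, one_mul]
    simp
  exact congrArg (fun f => f x) key

theorem mul_one' (x : TwistedGroupAlgebra α) : x * 1 = x := by
  have key : (mulMap α).flip 1 = LinearMap.id := by
    refine hom_ext α fun g => ?_
    change basisElt α g * 1 = basisElt α g
    rw [one_def, mul_smul', basisElt_mul, smul_smul, toFun_one_right α g, mul_one]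
    simp
  exact congrArg (fun f => f x) key

noncomputable instance : Ring (TwistedGroupAlgebra α) where
  __ := (inferInstance : AddCommGroup (TwistedGroupAlgebra α))
  mul := (· * ·)
  one := 1
  mul_assoc := mul_assoc' α
  one_mul := one_mul' α
  mul_one := mul_one' α
  left_distrib x y z := by simp [mul_def]
  right_distrib x y z := by simp [mul_def]
  zero_mul x := by simp [mul_def]
  mul_zero x := by simp [mul_def]

noncomputable instance : Algebra F (TwistedGroupAlgebra α) :=
  Algebra.ofModule (smul_mul' α) (mul_smul' α)

theorem toFun_inv_comm (g : G) : α.toFun g⁻¹ g = α.toFun g g⁻¹ := by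
  have h := α.cocycle g g⁻¹ g
  rw [mul_inv_cancel, inv_mul_cancel, toFun_one_left α g, toFun_one_right α g, mul_comm] at h
  exact (mul_left_cancel h).symm

/-- `U_g` as an invertible element of `F^α G`. -/
noncomputable def U (g : G) : (TwistedGroupAlgebra α)ˣ where
  val := basisElt α g
  inv := (((α.toFun g g⁻¹ * α.toFun 1 1)⁻¹ : Fˣ) : F) • basisElt α g⁻¹
  val_inv := by
    rw [mul_smul_comm, basisElt_mul, smul_smul, mul_inv_cancel, one_def, ← Units.val_mul]
    congr 2
    group
  inv_val := by
    rw [smul_mul_assoc, basisElt_mul, smul_smul, inv_mul_cancel, one_def, toFun_inv_comm,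
      ← Units.val_mul]
    congr 2
    group

/-- The homogeneous component `F U_g` of `F^α G`. -/
noncomputable def component (g : G) : Submodule F (TwistedGroupAlgebra α) :=
  Submodule.span F {(U α g : TwistedGroupAlgebra α)}

end TwistedGroupAlgebra

/-! ### The commutation matrix -/

/-- `α` corresponds to `θ`: the commutation function of `F^α G` is `τθ`. -/
def TwoCocycle.CorrespondsTo {G F : Type*} [Group G] [Field F] (α : TwoCocycle G F)
    (θ : ScalarFamily G F) : Prop :=
  HasCommutation (TwistedGroupAlgebra.component α) θ.grassmannTwist

/-- The matrix with entries `τ_{ψ(g),ψ(h)} U_g U_h U_g⁻¹ U_h⁻¹` in `F^α G`. -/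
noncomputable def commutationMatrix {G F : Type*} [Group G] [Field F] (α : TwoCocycle G F)
    (θ : ScalarFamily G F) : Matrix G G (TwistedGroupAlgebra α) :=
  Matrix.of fun g h =>
    (grassmannPair (θ.diag g) (θ.diag h) : F) •
      ((TwistedGroupAlgebra.U α g * TwistedGroupAlgebra.U α h * (TwistedGroupAlgebra.U α g)⁻¹ *
        (TwistedGroupAlgebra.U α h)⁻¹ : (TwistedGroupAlgebra α)ˣ) : TwistedGroupAlgebra α)

/-! Existence of the cocycle. Letters carry distinct labels, so by regularity a word can be nonzero
and the scalar of a reordering is unique (`IsReorderingScalar.unique`); computing one reordering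
along two routes then yields identities for `θ`. In this way `ψ` is a homomorphism, and exchanging
two blocks of equal degree `g` costs `ψ(g)`, whatever lies between them. The Grassmann sign of such
an exchange is also `ψ(g)`, so for `τθ` the exchange is free, and the twisted scalar depends only on
the words in `G`, not on their labels (`IsTwistedScalar.of_map_eq`).

Scalar multiples of words with trivial product, modulo reordering, therefore form a commutative
monoid in which no scalar `c ≠ 1` fixes an element. Since `Fˣ` is divisible, the identity of `Fˣ`
extends to a character of this monoid (`exists_evaluation`). Replacing one block by another of the
same degree changes the character by a factor independent of the context, and the factor of `[g, h]`
against `[gh]` is the cocycle.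

Singularity of the matrix. Let `g ≠ e` witness degeneracy and put `V_x = U_x U_g U_x⁻¹`. Multiplying
row `xgx⁻¹` on the left by `V_x⁻¹` gives the entry `V_{hx}⁻¹` in column `h`. The sum over `x` does
not depend on `h`, so it is a left multiple of the constant row `e`. This relation is nontrivial: by
degeneracy its coefficient at row `g` is `|C_G(g)| U_g⁻¹`, nonzero in characteristic zero. -/

/-! ### Scalars of reorderings of labelled words -/

section Reordering

variable {F G A : Type*} [Field F] [NonUnitalRing A] [Module F A]
  [IsScalarTower F A A] [SMulCommClass F A A]

/-- The product of the elements `a i` along a list of labels, taken in the unitization of `A`. -/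
def wordProd (F : Type*) {A : Type*} [Field F] [NonUnitalRing A] [Module F A]
    [IsScalarTower F A A] [SMulCommClass F A A] (a : ℕ → A) (L : List ℕ) : Unitization F A :=
  (L.map fun i => (a i : Unitization F A)).prod

@[simp]
theorem wordProd_nil (a : ℕ → A) : wordProd F a [] = 1 := rfl

@[simp]
theorem wordProd_cons (a : ℕ → A) (i : ℕ) (L : List ℕ) :
    wordProd F a (i :: L) = (a i : Unitization F A) * wordProd F a L := by
  simp [wordProd]

theorem wordProd_append (a : ℕ → A) (L M : List ℕ) :
    wordProd F a (L ++ M) = wordProd F a L * wordProd F a M := by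
  simp [wordProd]

theorem wordProd_congr {a b : ℕ → A} {L : List ℕ} (h : ∀ i ∈ L, a i = b i) :
    wordProd F a L = wordProd F b L := by
  unfold wordProd
  congr 1
  exact List.map_congr_left fun i hi => by rw [h i hi]

theorem wordProd_flatMap (a b : ℕ → A) (f : ℕ → List ℕ)
    (h : ∀ i, wordProd F a (f i) = (b i : Unitization F A)) (L : List ℕ) :
    wordProd F a (L.flatMap f) = wordProd F b L := by
  induction L with
  | nil => rfl
  | cons i L ih => rw [List.flatMap_cons, wordProd_append, ih, h, wordProd_cons]

theorem wordProd_ofFn {n : ℕ} (a : ℕ → A) (l : Fin (n + 1) → ℕ) :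
    wordProd F a (List.ofFn l) = (tupleProd (fun i => a (l i)) : A) := by
  induction n with
  | zero => simp [tupleProd]
  | succ n ih =>
    rw [List.ofFn_succ, wordProd_cons, ih (fun i => l i.succ), tupleProd, Unitization.inr_mul]

/-- Nonempty words of homogeneous elements are homogeneous. -/
theorem exists_wordProd_eq [Group G] [DecidableEq G] {𝒜 : G → Submodule F A} (h𝒜 : IsGroupGrading 𝒜)
    {d : ℕ → G} {a : ℕ → A} (ha : ∀ i, a i ∈ 𝒜 (d i)) {L : List ℕ} (hL : L ≠ []) :
    ∃ b ∈ 𝒜 (L.map d).prod, wordProd F a L = (b : Unitization F A) := by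
  induction L with
  | nil => exact absurd rfl hL
  | cons i L ih =>
    rcases eq_or_ne L [] with rfl | hne
    · exact ⟨a i, by simpa using ha i, by simp⟩
    · obtain ⟨b, hb, hb'⟩ := ih hne
      exact ⟨a i * b, by simpa using h𝒜.mul_mem (ha i) hb, by simp [hb', Unitization.inr_mul]⟩

/-- `s` is the scalar of the reordering of the word `L` of homogeneous elements to `L'`. -/
def IsReorderingScalar (𝒜 : G → Submodule F A) (d : ℕ → G) (L L' : List ℕ) (s : Fˣ) : Prop :=
  ∀ a : ℕ → A, (∀ i, a i ∈ 𝒜 (d i)) → wordProd F a L = (s : F) • wordProd F a L'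

namespace IsReorderingScalar

variable {𝒜 : G → Submodule F A} {d d' : ℕ → G} {L L' L'' : List ℕ} {s s' : Fˣ}

theorem refl (𝒜 : G → Submodule F A) (d : ℕ → G) (L : List ℕ) :
    IsReorderingScalar 𝒜 d L L 1 := fun a _ => by simp

theorem trans (h : IsReorderingScalar 𝒜 d L L' s) (h' : IsReorderingScalar 𝒜 d L' L'' s') :
    IsReorderingScalar 𝒜 d L L'' (s * s') := fun a ha => by
  rw [h a ha, h' a ha, smul_smul, Units.val_mul]

theorem symm (h : IsReorderingScalar 𝒜 d L L' s) : IsReorderingScalar 𝒜 d L' L s⁻¹ :=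
  fun a ha => by rw [h a ha, smul_smul, ← Units.val_mul]; simp

theorem append (h : IsReorderingScalar 𝒜 d L L' s) (M N : List ℕ) :
    IsReorderingScalar 𝒜 d (M ++ L ++ N) (M ++ L' ++ N) s := fun a ha => by
  simp [wordProd_append, h a ha]

theorem congr (h : IsReorderingScalar 𝒜 d L L' s) (hL : ∀ i ∈ L, d i = d' i)
    (hL' : ∀ i ∈ L', d i = d' i) : IsReorderingScalar 𝒜 d' L L' s := by
  classical
  intro a ha
  -- Labels outside the two words are irrelevant; zero belongs to every component.
  let b : ℕ → A := fun i => if d i = d' i then a i else 0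
  have hb : ∀ i, b i ∈ 𝒜 (d i) := fun i => by
    by_cases hi : d i = d' i
    · simpa [b, hi] using ha i
    · simp [b, hi]
  rw [wordProd_congr (b := b) (fun i hi => by simp [b, hL i hi]),
    wordProd_congr (a := a) (b := b) (fun i hi => by simp [b, hL' i hi])]
  exact h b hb

theorem map (f : ℕ → ℕ) (h : IsReorderingScalar 𝒜 (d ∘ f) L L' s) :
    IsReorderingScalar 𝒜 d (L.map f) (L'.map f) s := fun a ha => by
  have := h (a ∘ f) fun i => ha (f i)
  simpa [wordProd, Function.comp_def] using this

/-- A nonempty block is homogeneous, so it can play the role of a single letter. -/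
theorem flatMap [Group G] [DecidableEq G] (h𝒜 : IsGroupGrading 𝒜) (f : ℕ → List ℕ) (hf : ∀ i, f i ≠ [])
    (h : IsReorderingScalar 𝒜 (fun i => ((f i).map d).prod) L L' s) :
    IsReorderingScalar 𝒜 d (L.flatMap f) (L'.flatMap f) s := fun a ha => by
  choose b hb hb' using fun i => exists_wordProd_eq h𝒜 ha (hf i)
  rw [wordProd_flatMap a b f hb', wordProd_flatMap a b f hb']
  exact h b hb

theorem of_hasCommutation [Group G] {θ : ScalarFamily G F} (hθ : HasCommutation 𝒜 θ) (d : ℕ → G) {n : ℕ}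
    (l : Fin (n + 1) → ℕ) (σ : Equiv.Perm (Fin (n + 1))) (h : FixesProduct (d ∘ l) σ) :
    IsReorderingScalar 𝒜 d (List.ofFn l) (List.ofFn (l ∘ σ)) (θ n (d ∘ l) σ) := fun a ha => by
  rw [wordProd_ofFn, wordProd_ofFn, hθ n _ σ h (fun i => a (l i)) (fun i => ha (l i)),
    Unitization.inr_smul]
  rfl

theorem swap [Group G] {θ : ScalarFamily G F} (hθ : HasCommutation 𝒜 θ) {a b : ℕ} {g h : G} (ha : d a = g) (hb : d b = h) (hgh : g * h = h * g) :
    IsReorderingScalar 𝒜 d [a, b] [b, a] (θ.pair g h) := by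
  have key := of_hasCommutation hθ d ![a, b] (Equiv.swap 0 1)
    (by simp [FixesProduct, tupleProd, ha, hb, hgh])
  have : d ∘ ![a, b] = ![g, h] := by
    funext i; fin_cases i <;> simp [ha, hb]
  rw [this] at key
  simpa [List.ofFn_succ, ScalarFamily.pair] using key

end IsReorderingScalar

/-! ### Uniqueness of scalars and exchange of blocks of equal degree -/

variable [Group G] [DecidableEq G] {𝒜 : G → Submodule F A} {θ : ScalarFamily G F}

/-- Regularity chooses an element for each position; distinct labels turn this into a choice for
each label. -/
theorem IsRegularGrading.exists_wordProd_ne_zero (hreg : IsRegularGrading 𝒜 θ) (d : ℕ → G)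
    {L : List ℕ} (hL : L.Nodup) : ∃ a : ℕ → A, (∀ i, a i ∈ 𝒜 (d i)) ∧ wordProd F a L ≠ 0 := by
  obtain ⟨n, l, rfl⟩ : ∃ n, ∃ l : Fin n → ℕ, L = List.ofFn l := ⟨_, L.get, by simp⟩
  rw [List.nodup_ofFn] at hL
  cases n with
  | zero => exact ⟨0, fun i => by simp, by simp [List.ofFn_zero]⟩
  | succ n =>
    obtain ⟨b, hb, hb'⟩ := hreg.exists_ne_zero n (d ∘ l)
    classical
    refine ⟨fun i => if h : ∃ j, l j = i then b h.choose else 0, fun i => ?_, ?_⟩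
    · by_cases h : ∃ j, l j = i
      · have := hb h.choose
        simp only [Function.comp_apply, h.choose_spec] at this
        simpa [h] using this
      · simp [h]
    · rw [wordProd_ofFn]
      have : ∀ j, (⟨j, rfl⟩ : ∃ k, l k = l j).choose = j := fun j =>
        hL (⟨j, rfl⟩ : ∃ k, l k = l j).choose_spec
      intro h0
      apply hb'
      rw [← Unitization.inr_zero F] at h0
      have h1 := Unitization.inr_injective h0
      rw [← h1]
      congr 1
      funext j
      rw [dif_pos ⟨j, rfl⟩, this]

theorem IsReorderingScalar.unique (hreg : IsRegularGrading 𝒜 θ) {d : ℕ → G} {L L' : List ℕ}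
    (hL : L.Nodup) {s s' : Fˣ} (h : IsReorderingScalar 𝒜 d L L' s)
    (h' : IsReorderingScalar 𝒜 d L L' s') : s = s' := by
  obtain ⟨a, ha, hne⟩ := hreg.exists_wordProd_ne_zero d hL
  have h1 := h a ha
  rw [h' a ha] at h1
  have hne' : wordProd F a L' ≠ 0 := fun h0 => hne (by rw [h a ha, h0, smul_zero])
  exact Units.ext (smul_left_injective F hne' h1).symm

namespace IsRegularGrading

theorem diag_mul_self (hreg : IsRegularGrading 𝒜 θ) (g : G) : θ.diag g * θ.diag g = 1 := by
  have h (a b : ℕ) := IsReorderingScalar.swap hreg.hasCommutation (d := fun _ => g) (a := a) (b := b)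
    rfl rfl rfl
  exact ((h 0 1).trans (h 1 0)).unique hreg (by simp) (.refl _ _ _)

/-- Exchanging two letters of the same degree `g` costs `ψ(g)`, whatever is between them. -/
theorem isReorderingScalar_exchange_letters (hreg : IsRegularGrading 𝒜 θ) {d : ℕ → G} {a y b : ℕ}
    (hab : d a = d b) : IsReorderingScalar 𝒜 d [a, y, b] [b, y, a] (θ.diag (d a)) := by
  set g := d a with hg
  set h := d y with hh
  have three (d : ℕ → G) (a y b : ℕ) (ha : d a = g) (hy : d y = h) (hb : d b = g) :
      IsReorderingScalar 𝒜 d [a, y, b] [b, y, a] (θ 2 ![g, h, g] (Equiv.swap 0 2)) := by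
    have hs : (Equiv.swap (0 : Fin 3) 2) 1 = 1 := by decide
    have key := IsReorderingScalar.of_hasCommutation hreg.hasCommutation d ![a, y, b]
      (Equiv.swap 0 2) (by simp [FixesProduct, tupleProd, ha, hy, hb, hs])
    have : d ∘ ![a, y, b] = ![g, h, g] := by
      funext i; fin_cases i <;> simp [ha, hy, hb]
    rw [this] at key
    simpa [List.ofFn_succ, hs] using key
  suffices θ 2 ![g, h, g] (Equiv.swap 0 2) = θ.diag g by
    rw [← this]
    exact three d a y b rfl rfl hab.symm
  -- Labels 0, 2, 3 have degree `g`, label 1 has degree `h`. Taking 0123 to 3120 along two routes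
  -- gives `x ψ x = ψ x ψ` for the unknown scalar `x`, so `x = ψ(g)`.
  let e : ℕ → G := fun i => if i = 1 then h else g
  have two (a b : ℕ) (ha : a ≠ 1) (hb : b ≠ 1) : IsReorderingScalar 𝒜 e [a, b] [b, a] (θ.diag g) :=
    IsReorderingScalar.swap hreg.hasCommutation (by simp [e, ha]) (by simp [e, hb]) rfl
  have three' (a b : ℕ) (ha : a ≠ 1) (hb : b ≠ 1) := three e a 1 b (by simp [e, ha]) rfl
    (by simp [e, hb])
  have left := (((three' 0 2 (by simp) (by simp)).append [] [3]).trans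
    ((two 0 3 (by simp) (by simp)).append [2, 1] [])).trans
    ((three' 2 3 (by simp) (by simp)).append [] [0])
  have right := (((two 2 3 (by simp) (by simp)).append [0, 1] []).trans
    ((three' 0 3 (by simp) (by simp)).append [] [2])).trans
    ((two 0 2 (by simp) (by simp)).append [3, 1] [])
  have := left.unique hreg (by simp) right
  rw [mul_comm (θ.diag g) (θ 2 _ _)] at this
  exact mul_left_cancel this

theorem diag_mul (hreg : IsRegularGrading 𝒜 θ) (g h : G) :
    θ.diag (g * h) = θ.diag g * θ.diag h := by
  -- The word is `g h g h`: exchange its halves as blocks, or exchange the two `g` and then the two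
  -- `h`.
  let d : ℕ → G := fun i => if Even i then g else h
  let f : ℕ → List ℕ := fun i => if i = 0 then [0, 1] else [2, 3]
  have hf : ∀ i, f i ≠ [] := fun i => by by_cases hi : i = 0 <;> simp [f, hi]
  have hfd : ∀ i, ((f i).map d).prod = g * h := fun i => by
    have : ¬ Even 3 := by decide
    by_cases hi : i = 0 <;> simp [f, hi, d, this]
  have left : IsReorderingScalar 𝒜 d ([0, 1].flatMap f) ([1, 0].flatMap f) (θ.diag (g * h)) :=
    (IsReorderingScalar.swap hreg.hasCommutation (hfd 0) (hfd 1) rfl).flatMap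
      hreg.isGroupGrading f hf
  have right := ((hreg.isReorderingScalar_exchange_letters (d := d) (a := 0) (y := 1) (b := 2)
    rfl).append [] [3]).trans
    ((hreg.isReorderingScalar_exchange_letters (d := d) (a := 1) (y := 0) (b := 3)
    rfl).append [2] [])
  exact left.unique hreg (by simp [f]) right

/-- Exchanging two nonempty blocks of the same degree `g` costs `ψ(g)`. -/
theorem isReorderingScalar_exchange (hreg : IsRegularGrading 𝒜 θ) {d : ℕ → G} {u v : List ℕ}
    (y : List ℕ) (hu : u ≠ []) (hv : v ≠ []) (huv : (u.map d).prod = (v.map d).prod) :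
    IsReorderingScalar 𝒜 d (u ++ y ++ v) (v ++ y ++ u) (θ.diag (u.map d).prod) := by
  rcases eq_or_ne y [] with rfl | hy
  · let f : ℕ → List ℕ := fun i => if i = 0 then u else v
    have := (IsReorderingScalar.swap hreg.hasCommutation
      (d := fun i => ((f i).map d).prod) (a := 0) (b := 1) (g := (u.map d).prod)
      (h := (u.map d).prod) rfl huv.symm rfl).flatMap hreg.isGroupGrading f
      (fun i => by by_cases hi : i = 0 <;> simp [f, hi, hu, hv])
    simpa [f, ScalarFamily.diag] using this
  · let f : ℕ → List ℕ := fun i => if i = 0 then u else if i = 1 then y else v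
    have := (hreg.isReorderingScalar_exchange_letters
      (d := fun i => ((f i).map d).prod) (a := 0) (y := 1) (b := 2) huv).flatMap
      hreg.isGroupGrading f (fun i => by
        by_cases hi : i = 0 <;> by_cases hi' : i = 1 <;> simp [f, hi, hi', hu, hv, hy])
    simpa [f] using this

end IsRegularGrading

end Reordering

/-! ### Signs of reorderings -/

section Signs

variable {F : Type*} [Field F]

theorem grassmannPair_comm (s t : Fˣ) : grassmannPair s t = grassmannPair t s := by
  unfold grassmannPair
  by_cases h : s = -1 ∧ t = -1
  · rw [if_pos h, if_pos h.symm]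
  · rw [if_neg h, if_neg fun h' => h h'.symm]

theorem grassmannPair_mul_self (s t : Fˣ) : grassmannPair s t * grassmannPair s t = 1 := by
  unfold grassmannPair; split_ifs <;> simp

theorem grassmannPair_one_left [CharZero F] (t : Fˣ) : grassmannPair 1 t = 1 := by
  simp [grassmannPair]

theorem grassmannPair_one_right [CharZero F] (t : Fˣ) : grassmannPair t 1 = 1 := by
  rw [grassmannPair_comm, grassmannPair_one_left]

theorem units_eq_one_or_neg_one {s : Fˣ} (hs : s * s = 1) : s = 1 ∨ s = -1 := by
  have h := congrArg Units.val hs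
  push_cast at h
  exact (mul_self_eq_one_iff.1 h).imp (fun h => Units.ext h) (fun h => Units.ext (by simpa using h))

theorem grassmannPair_self [CharZero F] {s : Fˣ} (hs : s * s = 1) : grassmannPair s s = s := by
  rcases units_eq_one_or_neg_one hs with rfl | rfl
  · exact grassmannPair_one_left 1
  · simp [grassmannPair]

theorem grassmannPair_mul_right [CharZero F] {s t t' : Fˣ} (ht : t * t = 1) (ht' : t' * t' = 1) :
    grassmannPair s (t * t') = grassmannPair s t * grassmannPair s t' := by
  rcases units_eq_one_or_neg_one ht with rfl | rfl
  · simp [grassmannPair_one_right]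
  rcases units_eq_one_or_neg_one ht' with rfl | rfl
  · simp [grassmannPair_one_right]
  · rw [grassmannPair_mul_self, neg_mul_neg, one_mul, grassmannPair_one_right]

theorem list_prod_mul_self {p : ℕ → Fˣ} (hp : ∀ i, p i * p i = 1) (L : List ℕ) :
    (L.map p).prod * (L.map p).prod = 1 := by
  induction L with
  | nil => simp
  | cons a L ih => rw [List.map_cons, List.prod_cons, mul_mul_mul_comm, hp, ih, one_mul]

/-- The product of the factors `τ` of the letters of `L` that are inverted with `a :: L`. -/
noncomputable def inversionSign (p : ℕ → Fˣ) (a : ℕ) (L : List ℕ) : Fˣ :=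
  (L.map fun b => if b < a then grassmannPair (p a) (p b) else 1).prod

/-- The sign that puts the word `L` into increasing order. -/
noncomputable def orderSign (p : ℕ → Fˣ) : List ℕ → Fˣ
  | [] => 1
  | a :: L => inversionSign p a L * orderSign p L

variable {p : ℕ → Fˣ} {L L' : List ℕ}

theorem inversionSign_perm (a : ℕ) (h : L.Perm L') : inversionSign p a L = inversionSign p a L' :=
  (h.map _).prod_eq

theorem orderSign_append (L M : List ℕ) : orderSign p (L ++ M) =
    orderSign p L * orderSign p M * (L.map fun a => inversionSign p a M).prod := by
  induction L with
  | nil => simp [orderSign]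
  | cons a L ih =>
    simp only [List.cons_append, orderSign, ih, List.map_cons, List.prod_cons]
    simp only [inversionSign, List.map_append, List.prod_append]
    ac_rfl

/-- Inversions between a block and its surroundings depend only on the multiset of labels in the
block, so they cancel in the quotient. -/
theorem orderSign_append_div (h : L.Perm L') (M N : List ℕ) :
    orderSign p (M ++ L ++ N) / orderSign p (M ++ L' ++ N) = orderSign p L / orderSign p L' := by
  have h1 : (fun a => inversionSign p a L) = fun a => inversionSign p a L' :=
    funext fun a => inversionSign_perm a h
  have h2 : (L.map fun a => inversionSign p a N).prod = (L'.map fun a => inversionSign p a N).prod :=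
    (h.map _).prod_eq
  have key (K : List ℕ) : orderSign p (M ++ K ++ N) = orderSign p M * orderSign p N *
      ((M.map fun a => inversionSign p a K).prod * (M.map fun a => inversionSign p a N).prod *
        (K.map fun a => inversionSign p a N).prod) * orderSign p K := by
    simp only [orderSign_append, List.map_append, List.prod_append]
    ac_rfl
  rw [key, key, h1, h2, mul_div_mul_left_eq_div]

theorem orderSign_cons_div (h : L.Perm L') (a : ℕ) :
    orderSign p (a :: L) / orderSign p (a :: L') = orderSign p L / orderSign p L' := by
  simpa using orderSign_append_div h [a] []

theorem orderSign_swap {a b : ℕ} (hab : a ≠ b) (L : List ℕ) :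
    orderSign p (a :: b :: L) / orderSign p (b :: a :: L) = grassmannPair (p a) (p b) := by
  rw [div_eq_iff_eq_mul]
  have hinv := grassmannPair_mul_self (p a) (p b)
  rcases lt_or_gt_of_ne hab with h | h
  · simp only [orderSign, inversionSign, List.map_cons, List.prod_cons, h, h.not_gt, if_true,
      if_false, grassmannPair_comm (p b) (p a), one_mul, ← mul_assoc, hinv]
    ac_rfl
  · simp only [orderSign, inversionSign, List.map_cons, List.prod_cons, h, h.not_gt, if_true,
      if_false, one_mul, ← mul_assoc]
    ac_rfl

/-- Each order sign depends on how labels compare, but the quotient is a product over adjacent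
swaps, each of which sees only parities. -/
theorem orderSign_map_div (f : ℕ → ℕ) (h : L.Perm L') (hf : (L.map f).Nodup) :
    orderSign p (L.map f) / orderSign p (L'.map f) =
      orderSign (p ∘ f) L / orderSign (p ∘ f) L' := by
  induction h with
  | nil => simp [orderSign]
  | cons a h ih =>
    rw [List.map_cons, List.nodup_cons] at hf
    rw [List.map_cons, List.map_cons, orderSign_cons_div (h.map f), orderSign_cons_div h, ih hf.2]
  | swap a b L =>
    have hne : f b ≠ f a := fun h => by simp [h] at hf
    have hne' : b ≠ a := fun h => hne (by rw [h])
    simp only [List.map_cons]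
    rw [orderSign_swap hne, orderSign_swap hne']
    rfl
  | trans h₁ h₂ ih₁ ih₂ =>
    rw [← div_mul_div_cancel, ih₁ hf, ih₂ ((h₁.map f).nodup_iff.1 hf), div_mul_div_cancel]

theorem orderSign_congr {q : ℕ → Fˣ} (h : ∀ i ∈ L, p i = q i) : orderSign p L = orderSign q L := by
  induction L with
  | nil => rfl
  | cons a L ih =>
    rw [orderSign, orderSign, ih fun i hi => h i (by simp [hi]), inversionSign, inversionSign,
      List.map_congr_left fun b hb => by rw [h a (by simp), h b (by simp [hb])]]

theorem orderSign_ofFn {n : ℕ} (l : Fin n → ℕ) : orderSign p (List.ofFn l) =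
    ∏ i, ∏ j, if i < j ∧ l j < l i then grassmannPair (p (l i)) (p (l j)) else 1 := by
  induction n with
  | zero => simp [orderSign]
  | succ n ih =>
    rw [List.ofFn_succ, orderSign, ih, Fin.prod_univ_succ]
    congr 1
    · rw [Fin.prod_univ_succ, inversionSign, List.map_ofFn, List.prod_ofFn]
      simp
    · refine Finset.prod_congr rfl fun i _ => ?_
      rw [Fin.prod_univ_succ]
      simp

variable [CharZero F]

theorem orderSign_move (hp : ∀ i, p i * p i = 1) {a : ℕ} {V : List ℕ} (ha : a ∉ V) :
    orderSign p (a :: V) / orderSign p (V ++ [a]) = grassmannPair (p a) (V.map p).prod := by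
  induction V with
  | nil => simp [grassmannPair_one_right]
  | cons b V ih =>
    simp only [List.mem_cons, not_or] at ha
    have hperm : (a :: V).Perm (V ++ [a]) := (List.perm_append_singleton a V).symm
    rw [← div_mul_div_cancel, orderSign_swap ha.1, List.cons_append, orderSign_cons_div hperm,
      ih ha.2, List.map_cons, List.prod_cons, grassmannPair_mul_right (hp b) (list_prod_mul_self hp V)]

theorem orderSign_append_comm (hp : ∀ i, p i * p i = 1) {U V : List ℕ} (h : U.Disjoint V) :
    orderSign p (U ++ V) / orderSign p (V ++ U) =
      grassmannPair (U.map p).prod (V.map p).prod := by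
  induction U with
  | nil => simp [grassmannPair_one_left]
  | cons a U ih =>
    rw [List.disjoint_cons_left] at h
    have hperm : (a :: V).Perm (V ++ [a]) := (List.perm_append_singleton a V).symm
    have h1 := orderSign_append_div (p := p) hperm [] U
    simp only [List.nil_append, List.append_assoc, List.cons_append] at h1
    rw [List.cons_append, ← div_mul_div_cancel, orderSign_cons_div List.perm_append_comm, ih h.2, h1,
      orderSign_move hp h.1, List.map_cons, List.prod_cons, grassmannPair_comm (_ * _),
      grassmannPair_mul_right (hp a) (list_prod_mul_self hp U), mul_comm,
      grassmannPair_comm (p a), grassmannPair_comm (U.map p).prod]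

/-- Moving `u` past `y`, `u` past `v` and `y` past `v` gives three factors. As `u` and `v` have
equal parity `s`, the two involving `y` cancel, leaving `τ(s, s) = s`. -/
theorem orderSign_exchange (hp : ∀ i, p i * p i = 1) {u y v : List ℕ} (h : (u ++ y ++ v).Nodup)
    (huv : (u.map p).prod = (v.map p).prod) :
    orderSign p (u ++ y ++ v) / orderSign p (v ++ y ++ u) = (u.map p).prod := by
  have huy : u.Disjoint y := List.disjoint_of_nodup_append h.of_append_left
  have h' := List.disjoint_append_left.1 (List.disjoint_of_nodup_append h)
  have h1 := orderSign_append_div (p := p) (List.perm_append_comm (l₁ := u) (l₂ := y)) [] v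
  have h2 := orderSign_append_div (p := p) (List.perm_append_comm (l₁ := u) (l₂ := v)) y []
  have h3 := orderSign_append_div (p := p) (List.perm_append_comm (l₁ := y) (l₂ := v)) [] u
  simp only [List.nil_append, List.append_nil, List.append_assoc, orderSign_append_comm hp huy,
    orderSign_append_comm hp h'.1, orderSign_append_comm hp h'.2] at h1 h2 h3
  simp only [List.append_assoc]
  rw [← div_mul_div_cancel, h1, ← div_mul_div_cancel, h2, h3, ← huv,
    grassmannPair_self (list_prod_mul_self hp u), grassmannPair_comm (y.map p).prod, mul_left_comm,
    grassmannPair_mul_self, mul_one]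

end Signs

/-! ### Scalars of reorderings, corrected by signs -/

section Twisted

variable {F G A : Type*} [Field F] [NonUnitalRing A] [Module F A]
  [IsScalarTower F A A] [SMulCommClass F A A]

/-- `t` is the scalar of the reordering of the word `L` to `L'` for the commutation function `τθ`. -/
def IsTwistedScalar (𝒜 : G → Submodule F A) (θ : ScalarFamily G F) (d : ℕ → G) (L L' : List ℕ)
    (t : Fˣ) : Prop :=
  IsReorderingScalar 𝒜 d L L'
    (t * (orderSign (θ.diag ∘ d) L / orderSign (θ.diag ∘ d) L'))

namespace IsTwistedScalar

variable {𝒜 : G → Submodule F A} {θ : ScalarFamily G F} {d d' : ℕ → G} {L L' L'' : List ℕ}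
  {t t' : Fˣ}

theorem refl (𝒜 : G → Submodule F A) (θ : ScalarFamily G F) (d : ℕ → G) (L : List ℕ) :
    IsTwistedScalar 𝒜 θ d L L 1 := by
  simpa [IsTwistedScalar] using IsReorderingScalar.refl 𝒜 d L

theorem trans (h : IsTwistedScalar 𝒜 θ d L L' t) (h' : IsTwistedScalar 𝒜 θ d L' L'' t') :
    IsTwistedScalar 𝒜 θ d L L'' (t * t') := by
  have := IsReorderingScalar.trans h h'
  rwa [mul_mul_mul_comm, div_mul_div_cancel] at this

theorem symm (h : IsTwistedScalar 𝒜 θ d L L' t) : IsTwistedScalar 𝒜 θ d L' L t⁻¹ := by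
  have := IsReorderingScalar.symm h
  rwa [mul_inv, inv_div] at this

theorem append (h : IsTwistedScalar 𝒜 θ d L L' t) (hp : L.Perm L') (M N : List ℕ) :
    IsTwistedScalar 𝒜 θ d (M ++ L ++ N) (M ++ L' ++ N) t := by
  rw [IsTwistedScalar, orderSign_append_div hp]
  exact IsReorderingScalar.append h M N

theorem congr (h : IsTwistedScalar 𝒜 θ d L L' t) (hp : L.Perm L') (hd : ∀ i ∈ L, d i = d' i) :
    IsTwistedScalar 𝒜 θ d' L L' t := by
  have hd' : ∀ i ∈ L', d i = d' i := fun i hi => hd i (hp.mem_iff.2 hi)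
  have h1 : orderSign (θ.diag ∘ d) L = orderSign (θ.diag ∘ d') L :=
    orderSign_congr fun i hi => by simp [hd i hi]
  have h2 : orderSign (θ.diag ∘ d) L' = orderSign (θ.diag ∘ d') L' :=
    orderSign_congr fun i hi => by simp [hd' i hi]
  rw [IsTwistedScalar, ← h1, ← h2]
  exact IsReorderingScalar.congr h hd hd'

theorem map (f : ℕ → ℕ) (h : IsTwistedScalar 𝒜 θ (d ∘ f) L L' t) (hp : L.Perm L')
    (hf : (L.map f).Nodup) : IsTwistedScalar 𝒜 θ d (L.map f) (L'.map f) t := by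
  rw [IsTwistedScalar, orderSign_map_div f hp hf]
  exact IsReorderingScalar.map f h

end IsTwistedScalar

variable [Group G] [DecidableEq G] {𝒜 : G → Submodule F A} {θ : ScalarFamily G F}
  {d : ℕ → G} {L L' : List ℕ} {t t' : Fˣ}

theorem IsTwistedScalar.unique (hreg : IsRegularGrading 𝒜 θ) (hL : L.Nodup)
    (h : IsTwistedScalar 𝒜 θ d L L' t) (h' : IsTwistedScalar 𝒜 θ d L L' t') : t = t' :=
  mul_right_cancel (IsReorderingScalar.unique hreg hL h h')

theorem IsRegularGrading.map_diag_prod (hreg : IsRegularGrading 𝒜 θ) (L : List ℕ) :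
    θ.diag (L.map d).prod = (L.map (θ.diag ∘ d)).prod := by
  simpa using map_list_prod (MonoidHom.mk' θ.diag hreg.diag_mul) (L.map d)

variable [CharZero F]

/-- The purpose of the twist: the cost `ψ` of the exchange is exactly its Grassmann sign. -/
theorem IsTwistedScalar.exchange (hreg : IsRegularGrading 𝒜 θ) {u y v : List ℕ} (hu : u ≠ [])
    (hv : v ≠ []) (huv : (u.map d).prod = (v.map d).prod) (hnd : (u ++ y ++ v).Nodup) :
    IsTwistedScalar 𝒜 θ d (u ++ y ++ v) (v ++ y ++ u) 1 := by
  rw [IsTwistedScalar, one_mul, orderSign_exchange (p := θ.diag ∘ d) (fun i => hreg.diag_mul_self (d i)) hnd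
    (by rw [← hreg.map_diag_prod, huv, hreg.map_diag_prod]), ← hreg.map_diag_prod]
  exact hreg.isReorderingScalar_exchange y hu hv huv

theorem IsTwistedScalar.of_map_eq (hreg : IsRegularGrading 𝒜 θ) (hp : L.Perm L') (hL : L.Nodup)
    (h : L.map d = L'.map d) : IsTwistedScalar 𝒜 θ d L L' 1 := by
  induction L generalizing L' with
  | nil => rw [hp.nil_eq]; exact .refl _ _ _ _
  | cons a M ih =>
    cases L' with
    | nil => simp at h
    | cons b M' =>
      rw [List.map_cons, List.map_cons, List.cons.injEq] at h
      rw [List.nodup_cons] at hL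
      rcases eq_or_ne a b with rfl | hab
      · have hp' := hp.cons_inv
        simpa using (ih hp' hL.2 h.2).append hp' [a] []
      · have ha : a ∈ M' := by
          have := hp.mem_iff.1 (List.mem_cons_self (a := a) (l := M))
          simpa [hab] using this
        -- The target is `b y a z` with `a`, `b` of equal degree: reach `a y b z` by induction on
        -- the tail, then exchange `a` and `b` for free.
        obtain ⟨y, z, rfl⟩ := List.append_of_mem ha
        have hp' : M.Perm (y ++ b :: z) := by
          apply List.Perm.cons_inv (a := a)
          refine hp.trans ?_
          have : (b :: (y ++ a :: z)).Perm (b :: a :: (y ++ z)) := List.perm_middle.cons b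
          refine this.trans ((List.Perm.swap a b _).trans ?_)
          exact (List.perm_middle.symm).cons a
        have hnd : ([a] ++ y ++ [b] ++ z).Nodup := by
          have : (a :: M).Perm ([a] ++ y ++ [b] ++ z) := by simpa using hp'
          rw [← this.nodup_iff, List.nodup_cons]
          exact hL
        have step := (IsTwistedScalar.exchange (d := d) (u := [a]) (v := [b]) hreg (by simp)
          (by simp) (by simpa using h.1) hnd.of_append_left).append (by
            simp only [List.singleton_append]
            exact ((List.perm_append_singleton b y).cons a).trans ((List.Perm.swap b a y).trans
              ((List.perm_append_singleton a y).symm.cons b))) [] z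
        have hM := (ih hp' hL.2 (by simpa [h.1] using h.2)).append hp' [a] []
        simp only [List.append_assoc, List.cons_append, List.nil_append, List.append_nil]
          at step hM
        simpa using hM.trans step

end Twisted

/-! ### A multiplicative evaluation of the words with trivial product -/

section Evaluation

theorem exists_nodup_labels {G : Type*} [One G] (w : List G) :
    ∃ (d : ℕ → G) (L : List ℕ), L.Nodup ∧ L.map d = w := by
  refine ⟨fun i => w.getD i 1, List.range w.length, List.nodup_range, ?_⟩
  refine List.ext_getElem (by simp) fun i h1 h2 => ?_
  simp [h2]

theorem exists_map_eq {L L' : List ℕ} (hL : L.Nodup) (h : L.length = L'.length) :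
    ∃ f : ℕ → ℕ, L.map f = L' := by
  refine ⟨fun i => L'.getD (L.idxOf i) 0, List.ext_getElem (by simp [h]) fun i h1 h2 => ?_⟩
  have h3 : i < L.length := by simpa using h1
  rw [List.getElem_map, hL.idxOf_getElem i h3, List.getD_eq_getElem _ _ h2]

theorem baer_additive_units {F : Type*} [Field F] [IsAlgClosed F] : Module.Baer ℤ (Additive Fˣ) := by
  let : DivisibleBy (Additive Fˣ) ℕ := divisibleByOfSMulRightSurj _ _ fun {n} hn x => by
    obtain ⟨z, hz⟩ := IsAlgClosed.exists_pow_nat_eq (x.toMul : F) (Nat.pos_of_ne_zero hn)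
    have hz0 : z ≠ 0 := fun h => x.toMul.ne_zero (by rw [← hz, h, zero_pow hn])
    have hu : Units.mk0 z hz0 ^ n = x.toMul := Units.ext (by simpa using hz)
    exact ⟨Additive.ofMul (Units.mk0 z hz0), congrArg Additive.ofMul hu⟩
  let : DivisibleBy (Additive Fˣ) ℤ := AddGroup.divisibleByIntOfDivisibleByNat _
  exact Module.Baer.of_divisible _

/-- The hypothesis `hf` says that `Fˣ` stays embedded in the Grothendieck group of `N`; injectivity
of the divisible group `Fˣ` then extends the identity. -/
theorem exists_extension_to_units {F : Type*} [Field F] [IsAlgClosed F] {N : Type*} [CommMonoid N] (f : Fˣ →* N)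
    (hf : ∀ c n, f c * n = n → c = 1) : ∃ φ : N →* Fˣ, ∀ c, φ (f c) = c := by
  let ι : Fˣ →* Algebra.GrothendieckGroup N := Algebra.GrothendieckGroup.of.comp f
  have hι : Function.Injective ι := by
    rw [injective_iff_map_eq_one]
    intro c hc
    rw [← map_one Algebra.GrothendieckGroup.of] at hc
    obtain ⟨n, hn⟩ := (Submonoid.LocalizationMap.eq_iff_exists (Localization.monoidOf (⊤ : Submonoid N))).1 hc
    exact hf c n (by simpa [mul_comm] using hn)
  obtain ⟨φ, hφ⟩ := baer_additive_units.extension_property_addMonoidHom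
    (MonoidHom.toAdditive ι) hι (AddMonoidHom.id _)
  refine ⟨(MonoidHom.toAdditive.symm φ).comp Algebra.GrothendieckGroup.of, fun c => ?_⟩
  exact congrArg (fun g => (g (Additive.ofMul c)).toMul) hφ

/-! ### Words in `G` up to reordering, and their evaluation -/

variable {F G A : Type*} [Field F] [NonUnitalRing A] [Module F A]
  [IsScalarTower F A A] [SMulCommClass F A A]

/-- The word `w` is a reordering of `w'`, and `w = t w'` for the commutation function `τθ`. -/
def WordRel (𝒜 : G → Submodule F A) (θ : ScalarFamily G F) (w w' : List G) (t : Fˣ) : Prop :=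
  ∃ (d : ℕ → G) (L L' : List ℕ), L.Nodup ∧ L.Perm L' ∧ L.map d = w ∧ L'.map d = w' ∧
    IsTwistedScalar 𝒜 θ d L L' t

namespace WordRel

variable {𝒜 : G → Submodule F A} {θ : ScalarFamily G F} {w w' w'' v v' : List G} {t t' : Fˣ}

theorem symm (h : WordRel 𝒜 θ w w' t) : WordRel 𝒜 θ w' w t⁻¹ := by
  obtain ⟨d, L, L', hL, hp, rfl, rfl, ht⟩ := h
  exact ⟨d, L', L, hp.nodup_iff.1 hL, hp.symm, rfl, rfl, ht.symm⟩

theorem trans (h : WordRel 𝒜 θ w w' t) (h' : WordRel 𝒜 θ w' w'' t') :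
    WordRel 𝒜 θ w w'' (t * t') := by
  obtain ⟨d, L, L', hL, hp, rfl, rfl, ht⟩ := h
  obtain ⟨e, M, M', hM, hq, hMe, rfl, ht'⟩ := h'
  -- The two witnesses label the middle word differently; `f` carries the labels of the second to
  -- those of the first.
  obtain ⟨f, rfl⟩ := exists_map_eq hM (by simpa using congrArg List.length hMe)
  rw [List.map_map] at hMe
  have hd : ∀ i ∈ M, e i = (d ∘ f) i := List.map_inj_left.1 hMe
  refine ⟨d, L, M'.map f, hL, hp.trans (hq.map f), rfl, ?_, ht.trans
    ((ht'.congr hq hd).map f hq (hp.nodup_iff.1 hL))⟩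
  rw [List.map_map]
  exact List.map_congr_left fun i hi => (hd i (hq.mem_iff.2 hi)).symm

theorem append (h : WordRel 𝒜 θ w w' t) (h' : WordRel 𝒜 θ v v' t') :
    WordRel 𝒜 θ (w ++ v) (w' ++ v') (t * t') := by
  obtain ⟨d, L, L', hL, hp, rfl, rfl, ht⟩ := h
  obtain ⟨e, M, M', hM, hq, rfl, rfl, ht'⟩ := h'
  -- `N` exceeds every label of the first word, so shifting the second by `N` makes the labels
  -- disjoint.
  obtain ⟨N, hN⟩ : ∃ N, ∀ i ∈ L, i < N :=
    ⟨L.sum + 1, fun i hi => Nat.lt_succ_of_le (List.single_le_sum (by simp) i hi)⟩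
  let c : ℕ → G := fun i => if i < N then d i else e (i - N)
  have hc : ∀ i ∈ L, d i = c i := fun i hi => by simp [c, hN i hi]
  have hc' : ∀ i ∈ L', d i = c i := fun i hi => hc i (hp.mem_iff.2 hi)
  have hce : c ∘ (· + N) = e := by funext i; simp [c]
  have hMN : (M.map (· + N)).Nodup := hM.map (add_left_injective N)
  have h1 := (ht.congr hp hc).append hp [] (M.map (· + N))
  have h2 := IsTwistedScalar.map (d := c) (· + N) (hce ▸ ht') hq hMN
  have h3 := h2.append (hq.map _) L' []
  simp only [List.nil_append, List.append_nil] at h1 h3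
  refine ⟨c, L ++ M.map (· + N), L' ++ M'.map (· + N), ?_, hp.append (hq.map _), ?_, ?_,
    h1.trans h3⟩
  · refine hL.append hMN fun i hi hi' => ?_
    obtain ⟨j, -, rfl⟩ := List.mem_map.1 hi'
    have := hN _ hi
    omega
  · rw [List.map_append, List.map_map, hce, List.map_congr_left hc]
  · rw [List.map_append, List.map_map, hce, List.map_congr_left hc']

variable [Group G]

theorem refl (𝒜 : G → Submodule F A) (θ : ScalarFamily G F) (w : List G) :
    WordRel 𝒜 θ w w 1 := by
  obtain ⟨d, L, hL, rfl⟩ := exists_nodup_labels w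
  exact ⟨d, L, L, hL, .refl _, rfl, rfl, .refl _ _ _ _⟩

variable [DecidableEq G] [CharZero F]

/-- This is the consistency of `τθ` on unlabelled words; it keeps `Fˣ` embedded in the quotient
monoid. -/
theorem eq_one (hreg : IsRegularGrading 𝒜 θ) (h : WordRel 𝒜 θ w w t) : t = 1 := by
  obtain ⟨d, L, L', hL, hp, rfl, hL', ht⟩ := h
  exact ht.unique hreg hL (.of_map_eq hreg hp hL hL'.symm)

theorem exchange (hreg : IsRegularGrading 𝒜 θ) {u v : List G} (hu : u ≠ []) (hv : v ≠ [])
    (huv : u.prod = v.prod) (x y z : List G) :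
    WordRel 𝒜 θ (x ++ (u ++ y ++ v) ++ z) (x ++ (v ++ y ++ u) ++ z) 1 := by
  suffices WordRel 𝒜 θ (u ++ y ++ v) (v ++ y ++ u) 1 by
    simpa using ((refl 𝒜 θ x).append this).append (refl 𝒜 θ z)
  obtain ⟨d, L, hL, hw⟩ := exists_nodup_labels (u ++ y ++ v)
  obtain ⟨L', V, rfl, hw', rfl⟩ := List.map_eq_append_iff.1 hw
  obtain ⟨U, Y, rfl, rfl, rfl⟩ := List.map_eq_append_iff.1 hw'
  refine ⟨d, _, V ++ Y ++ U, hL, ?_, by simp, by simp, .exchange hreg (by simpa using hu)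
    (by simpa using hv) huv hL⟩
  rw [List.append_assoc V]
  exact List.perm_append_comm.trans (List.perm_append_comm.append_left V)

theorem append_comm (hreg : IsRegularGrading 𝒜 θ) {u v : List G} (hu : u.prod = 1)
    (hv : v.prod = 1) : WordRel 𝒜 θ (u ++ v) (v ++ u) 1 := by
  rcases eq_or_ne u [] with rfl | hu'
  · simpa using refl 𝒜 θ v
  rcases eq_or_ne v [] with rfl | hv'
  · simpa using refl 𝒜 θ u
  simpa using exchange hreg hu' hv' (hu.trans hv.symm) [] [] []

end WordRel

variable [Group G] {𝒜 : G → Submodule F A} {θ : ScalarFamily G F}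

/-- Scalar multiples of words with trivial product. -/
abbrev ScaledWord (G F : Type*) [Group G] [Field F] : Type _ :=
  MonoidHom.mker (FreeMonoid.lift (id : G → G)) × Fˣ

/-- The underlying list of letters. -/
def ScaledWord.letters (x : ScaledWord G F) : List G := FreeMonoid.toList x.1.1

theorem ScaledWord.prod_letters (x : ScaledWord G F) : x.letters.prod = 1 := by
  have := x.1.2
  rw [MonoidHom.mem_mker, FreeMonoid.lift_apply, List.map_id] at this
  exact this

/-- Identification of words with the multiples of their reorderings. -/
def wordCon (𝒜 : G → Submodule F A) (θ : ScalarFamily G F) : Con (ScaledWord G F) where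
  -- The pair `(w, c)` stands for `c w`, and `c w = c' w'` means `w = (c' c⁻¹) w'`.
  r x y := WordRel 𝒜 θ x.letters y.letters (y.2 * x.2⁻¹)
  iseqv :=
    { refl := fun x => by simpa using WordRel.refl 𝒜 θ x.letters
      symm := fun h => by simpa using h.symm
      trans := fun {x y z} h h' => by
        have := h.trans h'
        rwa [mul_comm, mul_assoc, inv_mul_cancel_left] at this }
  mul' := fun {x y z w} h h' => by
    have := WordRel.append h h'
    rwa [mul_mul_mul_comm, ← mul_inv] at this

variable [DecidableEq G] [CharZero F]

/-- The words with trivial product commute. -/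
noncomputable abbrev wordConCommMonoid (hreg : IsRegularGrading 𝒜 θ) :
    CommMonoid (wordCon 𝒜 θ).Quotient where
  mul_comm x y := by
    induction x, y using Con.induction_on₂ with
    | H x y =>
      refine (Con.eq _).2 ?_
      have := WordRel.append_comm hreg x.prod_letters y.prod_letters
      change WordRel 𝒜 θ (x.letters ++ y.letters) (y.letters ++ x.letters)
        ((y.2 * x.2) * (x.2 * y.2)⁻¹)
      rwa [mul_comm y.2, mul_inv_cancel]

theorem exists_evaluation [IsAlgClosed F] (hreg : IsRegularGrading 𝒜 θ) : ∃ e : List G → Fˣ,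
    (∀ w w', w.prod = 1 → w'.prod = 1 → e (w ++ w') = e w * e w') ∧
      ∀ w w' t, w.prod = 1 → w'.prod = 1 → WordRel 𝒜 θ w w' t → e w = t * e w' := by
  let := wordConCommMonoid hreg
  let f : Fˣ →* (wordCon 𝒜 θ).Quotient := (wordCon 𝒜 θ).mk'.comp (MonoidHom.inr _ _)
  obtain ⟨φ, hφ⟩ := exists_extension_to_units f fun c n h => by
    induction n using Con.induction_on with
    | H x =>
      have h1 : WordRel 𝒜 θ x.letters x.letters (x.2 * (c * x.2)⁻¹) := (Con.eq _).1 h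
      simpa using h1.eq_one hreg
  let m (w : List G) (hw : w.prod = 1) : ScaledWord G F :=
    (⟨FreeMonoid.ofList w, by simpa [MonoidHom.mem_mker, FreeMonoid.lift_apply] using hw⟩, 1)
  let e (w : List G) : Fˣ := if hw : w.prod = 1 then φ ((wordCon 𝒜 θ).mk' (m w hw)) else 1
  have he (w : List G) (hw : w.prod = 1) : e w = φ ((wordCon 𝒜 θ).mk' (m w hw)) := dif_pos hw
  refine ⟨e, fun w w' hw hw' => ?_, fun w w' t hw hw' h => ?_⟩
  · have hww : (w ++ w').prod = 1 := by simp [hw, hw']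
    rw [he w hw, he w' hw', he _ hww, ← map_mul, ← map_mul]
    congr 2
    exact Prod.ext rfl (one_mul 1).symm
  · rw [he w hw, he w' hw', ← hφ t, ← map_mul]
    congr 1
    refine (Con.eq _).2 ?_
    change WordRel 𝒜 θ w w' ((t * 1) * 1⁻¹)
    simpa using h

end Evaluation

/-! ### The corresponding cocycle -/

section Cocycle

variable {F G A : Type*} [Field F] [Group G]

namespace TwistedGroupAlgebra

theorem tupleProd_smul {S : Type*} [Ring S] [Algebra F S] {n : ℕ} (c : Fin (n + 1) → F)
    (a : Fin (n + 1) → S) : tupleProd (fun i => c i • a i) = (∏ i, c i) • tupleProd a := by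
  induction n with
  | zero => simp [tupleProd]
  | succ n ih =>
    rw [tupleProd, ih (fun i => c i.succ) (fun i => a i.succ), smul_mul_smul_comm,
      Fin.prod_univ_succ c, tupleProd]

/-- It suffices to check the commutation condition on the basis elements. -/
theorem correspondsTo_of_basis {α : TwoCocycle G F} {θ : ScalarFamily G F}
    (h : ∀ (n : ℕ) (g : Fin (n + 1) → G) (σ : Equiv.Perm (Fin (n + 1))), FixesProduct g σ →
      tupleProd (fun i => basisElt α (g i)) =
        (θ.grassmannTwist n g σ : F) • tupleProd (fun i => basisElt α (g (σ i)))) :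
    α.CorrespondsTo θ := by
  intro n g σ hσ a ha
  choose c hc using fun i => Submodule.mem_span_singleton.1 (ha i)
  obtain rfl : a = fun i => c i • basisElt α (g i) := funext fun i => (hc i).symm
  have h2 : (fun i => c i • basisElt α (g i)) ∘ σ = fun i => c (σ i) • basisElt α (g (σ i)) := rfl
  rw [h2, tupleProd_smul, tupleProd_smul, h n g σ hσ, Equiv.prod_comp σ c, smul_comm]

/-- The product of basis elements, when the values of the cocycle are quotients of values of a
function on words. -/
theorem tupleProd_basisElt {α : TwoCocycle G F} {n : ℕ} (c : List G → Fˣ)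
    (hc : ∀ g, c [g] = 1) (h : ∀ g w, w ≠ [] → c (g :: w) = c w * α.toFun g w.prod)
    (g : Fin (n + 1) → G) : tupleProd (fun i => basisElt α (g i)) =
      (c (List.ofFn g) : F) • basisElt α (List.ofFn g).prod := by
  induction n with
  | zero => simp [tupleProd, hc]
  | succ n ih =>
    rw [tupleProd, ih (fun i => g i.succ), List.ofFn_succ (f := g),
      h _ _ (List.ne_nil_of_length_pos (by simp)), mul_smul_comm, basisElt_mul, smul_smul, List.prod_cons, Units.val_mul]

end TwistedGroupAlgebra

/-! ### Construction of the cocycle from the evaluation -/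

variable [NonUnitalRing A] [Module F A] [IsScalarTower F A A] [SMulCommClass F A A]
  {𝒜 : G → Submodule F A} {θ : ScalarFamily G F}

theorem WordRel.of_fixesProduct (hθ : HasCommutation 𝒜 θ) {n : ℕ} (g : Fin (n + 1) → G)
    (σ : Equiv.Perm (Fin (n + 1))) (h : FixesProduct g σ) :
    WordRel 𝒜 θ (List.ofFn g) (List.ofFn (g ∘ σ)) (θ.grassmannTwist n g σ) := by
  -- Letters are labelled by position, so the original word has sign 1 and the reordered one has
  -- sign `grassmannTuple`.
  let d : ℕ → G := fun i => if h : i < n + 1 then g ⟨i, h⟩ else 1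
  let l : Fin (n + 1) → ℕ := Fin.val
  have hd : d ∘ l = g := by funext i; exact dif_pos i.isLt
  refine ⟨d, List.ofFn l, List.ofFn (l ∘ σ), List.nodup_ofFn.2 Fin.val_injective,
    (Equiv.Perm.ofFn_comp_perm σ l).symm, by rw [List.map_ofFn, hd],
    by rw [List.map_ofFn, ← Function.comp_assoc, hd], ?_⟩
  have key := IsReorderingScalar.of_hasCommutation hθ d l σ (by rwa [hd])
  have h1 : orderSign (θ.diag ∘ d) (List.ofFn l) = 1 := by
    rw [orderSign_ofFn]
    refine Finset.prod_eq_one fun i _ => Finset.prod_eq_one fun j _ => if_neg ?_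
    rintro ⟨h, h'⟩
    exact lt_asymm h (Fin.lt_def.2 h')
  have h2 : orderSign (θ.diag ∘ d) (List.ofFn (l ∘ σ)) =
      grassmannTuple (fun i => θ.diag (g i)) σ := by
    rw [orderSign_ofFn]
    simp only [grassmannTuple, ← hd]
    rfl
  rw [IsTwistedScalar, h1, h2, ScalarFamily.grassmannTwist, mul_right_comm, one_div,
    mul_inv_cancel, one_mul]
  rwa [hd] at key

theorem IsRegularGrading.exists_correspondsTo [DecidableEq G] [IsAlgClosed F] [CharZero F]
    (hreg : IsRegularGrading 𝒜 θ) :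
    ∃ α : TwoCocycle G F, α.CorrespondsTo θ := by
  obtain ⟨e, he, hrel⟩ := exists_evaluation hreg
  have hex (u v y z : List G) (hu : u ≠ []) (hv : v ≠ []) (huv : u.prod = v.prod)
      (x : List G) (h : (x ++ (u ++ y ++ v) ++ z).prod = 1) :
      e (x ++ (u ++ y ++ v) ++ z) = e (x ++ (v ++ y ++ u) ++ z) := by
    have h' : (x ++ (v ++ y ++ u) ++ z).prod = 1 := by
      rw [← h]
      simp [huv]
    simpa using hrel _ _ 1 h h' (WordRel.exchange hreg hu hv huv x y z)
  -- replacing a block by another block of the same degree costs a factor that only depends on the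
  -- two blocks
  have hblock (u v x z : List G) (hu : u ≠ []) (hv : v ≠ []) (huv : u.prod = v.prod)
      (h : (x ++ u ++ z).prod = 1) :
      e (x ++ u ++ z) * e (v ++ [v.prod⁻¹]) = e (x ++ v ++ z) * e (u ++ [v.prod⁻¹]) := by
    have h' : (x ++ v ++ z).prod = 1 := by rw [← h]; simp [huv]
    -- Multiplicativity merges each side into one word, where `u` and `v` are exchanged across `z`.
    rw [← he _ _ h (by simp), ← he _ _ h' (by simp [huv])]
    have := hex u v z [v.prod⁻¹] hu hv huv x (by
      have : (x ++ (u ++ z ++ v) ++ [v.prod⁻¹]).prod = (x ++ u ++ z).prod := by simp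
      rw [this, h])
    simpa using this
  -- The factor for contracting `[g, h]` to `[gh]`; the letter `(gh)⁻¹` makes the products trivial.
  let a (g h : G) : Fˣ := e [g, h, (g * h)⁻¹] / e [g * h, (g * h)⁻¹]
  have ha (g h : G) (x z : List G) (hz : (x ++ [g, h] ++ z).prod = 1) :
      a g h * e (x ++ [g * h] ++ z) = e (x ++ [g, h] ++ z) := by
    have := hblock [g, h] [g * h] x z (by simp) (by simp) (by simp) hz
    simp only [List.prod_singleton, List.cons_append, List.nil_append] at this
    rw [div_mul_eq_mul_div, div_eq_iff_eq_mul, mul_comm, ← this]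
  let α : TwoCocycle G F :=
    { toFun := a
      cocycle := fun g h k => by
        have h1 := ha (g * h) k [] [(g * h * k)⁻¹] (by simp [mul_assoc])
        have h2 := ha g h [] [k, (g * h * k)⁻¹] (by simp [mul_assoc])
        have h3 := ha h k [g] [(g * h * k)⁻¹] (by simp [mul_assoc])
        have h4 := ha g (h * k) [] [(g * h * k)⁻¹] (by simp [mul_assoc])
        simp only [List.nil_append, List.cons_append, ← mul_assoc] at h1 h2 h3 h4
        -- The word `g h k (ghk)⁻¹` is contracted in two orders.
        have key : a g h * a (g * h) k * e [g * h * k, (g * h * k)⁻¹] =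
            a g (h * k) * a h k * e [g * h * k, (g * h * k)⁻¹] := by
          rw [mul_assoc (a g h), h1, h2, mul_comm (a g (h * k)), mul_assoc (a h k), h4, h3]
        exact mul_right_cancel key }
  -- The factor for contracting a whole word `w` to one letter, hence the coefficient of `U_{g₁} ⋯
  -- U_{gₙ}`.
  let c (w : List G) : Fˣ := e (w ++ [w.prod⁻¹]) / e [w.prod, w.prod⁻¹]
  refine ⟨α, TwistedGroupAlgebra.correspondsTo_of_basis fun n g σ hσ => ?_⟩
  have hmul := TwistedGroupAlgebra.tupleProd_basisElt (α := α) (n := n) c (by simp [c])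
    (fun g w hw => by
      have h1 := hblock w [w.prod] [g] [(g * w.prod)⁻¹] hw (by simp) (by simp) (by simp)
      have h2 := ha g w.prod [] [(g * w.prod)⁻¹] (by simp)
      simp only [List.prod_singleton, List.cons_append, List.nil_append] at h1 h2
      change e (g :: w ++ [(g :: w).prod⁻¹]) / e [(g :: w).prod, (g :: w).prod⁻¹] =
        e (w ++ [w.prod⁻¹]) / e [w.prod, w.prod⁻¹] * a g w.prod
      rw [div_mul_eq_mul_div, div_eq_div_iff_mul_eq_mul, List.prod_cons, List.cons_append, h1, ← h2]
      ac_rfl)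
  have hprod : (List.ofFn (g ∘ σ)).prod = (List.ofFn g).prod := by
    rw [← tupleProd_eq_prod_ofFn, ← tupleProd_eq_prod_ofFn]
    exact hσ.symm
  have hw := (WordRel.of_fixesProduct hreg.hasCommutation g σ hσ).append
    (WordRel.refl 𝒜 θ [(List.ofFn g).prod⁻¹])
  have hew := hrel _ _ _ (by simp [-List.ofFn_succ]) (by simp [hprod, -List.ofFn_succ]) hw
  have hc : c (List.ofFn g) = θ.grassmannTwist n g σ * c (List.ofFn (g ∘ σ)) := by
    simp only [c, hprod]
    rw [hew, mul_one, mul_div_assoc]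
  have h2 := hmul (g ∘ σ)
  simp only [Function.comp_apply] at h2
  rw [hmul g, h2, smul_smul, ← Units.val_mul, hprod]
  rw [hc]

end Cocycle

/-! ### Degenerate gradings -/

section Degenerate

namespace TwistedGroupAlgebra

variable {G F : Type*} [Group G] [Field F] (α : TwoCocycle G F)

theorem basisElt_ne_zero (g : G) : basisElt α g ≠ 0 :=
  Finsupp.single_ne_zero.2 one_ne_zero

/-- Nonzero scalars as units. -/
noncomputable def scalarUnit : Fˣ →* (TwistedGroupAlgebra α)ˣ :=
  Units.map (algebraMap F (TwistedGroupAlgebra α)).toMonoidHom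

theorem scalarUnit_mul_comm (c : Fˣ) (x : (TwistedGroupAlgebra α)ˣ) :
    scalarUnit α c * x = x * scalarUnit α c :=
  Units.ext (Algebra.commutes (c : F) (x : TwistedGroupAlgebra α))

theorem U_mul (g h : G) : U α g * U α h = scalarUnit α (α.toFun g h) * U α (g * h) :=
  Units.ext ((basisElt_mul α g h).trans (Algebra.smul_def _ _))

theorem U_one_mul_comm (h : G) : U α 1 * U α h = U α h * U α 1 := by
  rw [U_mul, U_mul, toFun_one_left α h, toFun_one_right α h, one_mul, mul_one]

/-- Scalars cancel in conjugates. -/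
theorem scalarUnit_conj (c : Fˣ) (x y : (TwistedGroupAlgebra α)ˣ) :
    scalarUnit α c * x * y * (scalarUnit α c * x)⁻¹ = x * y * x⁻¹ := by
  rw [mul_assoc (scalarUnit α c), scalarUnit_mul_comm, scalarUnit_mul_comm α c x]
  rw [mul_inv_rev, mul_assoc (x * y), mul_inv_cancel_left]

/-- With `x = U_{kgk⁻¹}` and `c x = V_k`, this takes a matrix entry to the inverse of a conjugate of
`V_k`. -/
theorem scalarUnit_commutator (c : Fˣ) (x y : (TwistedGroupAlgebra α)ˣ) :
    (scalarUnit α c * x)⁻¹ * (x * y * x⁻¹ * y⁻¹) = (y * (scalarUnit α c * x) * y⁻¹)⁻¹ := by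
  rw [mul_assoc y, mul_assoc (scalarUnit α c), scalarUnit_mul_comm, scalarUnit_mul_comm]
  group

theorem U_conj (g h x : G) :
    U α (h * x) * U α g * (U α (h * x))⁻¹ =
      U α h * (U α x * U α g * (U α x)⁻¹) * (U α h)⁻¹ := by
  rw [← scalarUnit_conj α (α.toFun h x), ← U_mul]
  group

theorem exists_conj_eq (g x : G) :
    ∃ c, U α x * U α g * (U α x)⁻¹ = scalarUnit α c * U α (x * g * x⁻¹) := by
  refine ⟨α.toFun x g * (α.toFun (x * g * x⁻¹) x)⁻¹, ?_⟩
  rw [mul_inv_eq_iff_eq_mul, U_mul, mul_assoc _ _ (U α x), U_mul, inv_mul_cancel_right, ← mul_assoc,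
    ← map_mul, inv_mul_cancel_right]

end TwistedGroupAlgebra

open TwistedGroupAlgebra

theorem TwoCocycle.CorrespondsTo.commute {F G : Type*} [Field F] [CharZero F] [Group G]
    {θ : ScalarFamily G F} {α : TwoCocycle G F} (hα : α.CorrespondsTo θ) {g h : G}
    (hgh : g * h = h * g) (hg : θ.diag g = 1) (hθ : θ.pair g h = 1) :
    U α g * U α h = U α h * U α g := by
  have key := hα 1 ![g, h] (Equiv.swap 0 1) (by simp [FixesProduct, tupleProd, hgh])
    (fun i => (U α (![g, h] i) : TwistedGroupAlgebra α))
    (fun i => Submodule.mem_span_singleton_self _)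
  have ht : θ.grassmannTwist 1 ![g, h] (Equiv.swap 0 1) = 1 := by
    have h1 : θ 1 ![g, h] (Equiv.swap 0 1) = 1 := hθ
    simp [ScalarFamily.grassmannTwist, h1, grassmannTuple, Fin.prod_univ_two, hg,
      grassmannPair_one_right]
  rw [ht, Units.val_one, one_smul] at key
  exact Units.ext (by simpa [tupleProd] using key)

variable {F G A : Type*} [Field F] [CharZero F] [Group G] [Fintype G] [DecidableEq G]
  [NonUnitalRing A] [Module F A] [IsScalarTower F A A] [SMulCommClass F A A]
  {𝒜 : G → Submodule F A} {θ : ScalarFamily G F}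

theorem IsRegularGrading.not_isUnit_commutationMatrix (hreg : IsRegularGrading 𝒜 θ)
    (hdeg : ¬ θ.Nondegenerate) {α : TwoCocycle G F} (hα : α.CorrespondsTo θ) :
    ¬ IsUnit (commutationMatrix α θ) := by
  simp only [ScalarFamily.Nondegenerate, not_forall, not_exists, not_and, not_not] at hdeg
  obtain ⟨g, hg, hpair⟩ := hdeg
  -- `g` lies in its own centralizer.
  have hψ : θ.diag g = 1 := hpair g (by simp [Subgroup.mem_centralizer_singleton_iff])
  have hψ' (x : G) : θ.diag (x * g * x⁻¹) = 1 := by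
    rw [hreg.diag_mul, mul_comm, ← hreg.diag_mul, inv_mul_cancel_left, hψ]
  have hψ1 : θ.diag 1 = 1 := by
    have := hreg.diag_mul 1 1
    rwa [mul_one, left_eq_mul] at this
  let V (x : G) : (TwistedGroupAlgebra α)ˣ := U α x * U α g * (U α x)⁻¹
  let z : TwistedGroupAlgebra α := ∑ x, ((V x)⁻¹ : (TwistedGroupAlgebra α)ˣ)
  -- Coefficients of the left linear relation between the rows; `z` is the common column value,
  -- removed by row `e`.
  let u : G → TwistedGroupAlgebra α :=
    ∑ x, Pi.single (x * g * x⁻¹) (((V x)⁻¹ : (TwistedGroupAlgebra α)ˣ) : TwistedGroupAlgebra α) -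
      Pi.single 1 z
  have hrow (x h : G) :
      (((V x)⁻¹ : (TwistedGroupAlgebra α)ˣ) : TwistedGroupAlgebra α) *
        commutationMatrix α θ (x * g * x⁻¹) h = ((V (h * x))⁻¹ : (TwistedGroupAlgebra α)ˣ) := by
    rw [commutationMatrix, Matrix.of_apply, hψ', grassmannPair_one_left, Units.val_one, one_smul,
      ← Units.val_mul]
    congr 1
    obtain ⟨c, hc⟩ := exists_conj_eq α g x
    have hV : V (h * x) = U α h * V x * (U α h)⁻¹ := U_conj α g h x
    rw [hV, show V x = _ from hc, scalarUnit_commutator]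
  have hone (h : G) : commutationMatrix α θ 1 h = 1 := by
    rw [commutationMatrix, Matrix.of_apply, hψ1, grassmannPair_one_left, Units.val_one, one_smul,
      U_one_mul_comm, mul_inv_cancel_right, mul_inv_cancel, Units.val_one]
  have hu : Matrix.vecMul u (commutationMatrix α θ) = 0 := by
    funext h
    simp only [u, Matrix.sub_vecMul, Matrix.sum_vecMul, Pi.sub_apply, Finset.sum_apply,
      Matrix.single_vecMul, Pi.smul_apply, Matrix.row, smul_eq_mul, hrow, hone, mul_one,
      Pi.zero_apply, z]
    rw [sub_eq_zero]
    -- Reindexing by `x ↦ hx` shows that the sum is the same in every column.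
    exact Equiv.sum_comp (Equiv.mulLeft h)
      fun x => (((V x)⁻¹ : (TwistedGroupAlgebra α)ˣ) : TwistedGroupAlgebra α)
  have hug : u g ≠ 0 := by
    -- Only `x` in the centralizer contribute to the coefficient at `g`. Degeneracy makes their
    -- terms equal, so nothing cancels.
    have hV (x : G) (hx : g = x * g * x⁻¹) : V x = U α g := by
      have hgx : g * x = x * g := eq_mul_inv_iff_mul_eq.1 hx
      have := hα.commute hgx hψ (hpair x (Subgroup.mem_centralizer_singleton_iff.2 hgx.symm))
      rw [mul_inv_eq_iff_eq_mul, this]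
    have h1 : u g = ∑ x, if g = x * g * x⁻¹ then
        (((U α g)⁻¹ : (TwistedGroupAlgebra α)ˣ) : TwistedGroupAlgebra α) else 0 := by
      simp only [u, Pi.sub_apply, Finset.sum_apply, Pi.single_apply, hg, if_false, sub_zero]
      exact Finset.sum_congr rfl fun x _ => by
        by_cases hx : g = x * g * x⁻¹
        · rw [if_pos hx, if_pos hx, hV x hx]
        · rw [if_neg hx, if_neg hx]
    rw [h1, ← Finset.sum_filter, Finset.sum_const, ← Nat.cast_smul_eq_nsmul F]
    refine smul_ne_zero (Nat.cast_ne_zero.2 (Finset.card_ne_zero.2 ⟨1, by simp⟩)) fun h0 => ?_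
    have h2 := (U α g).mul_inv
    rw [h0, mul_zero] at h2
    apply basisElt_ne_zero α g
    rw [← mul_one (basisElt α g), ← h2, mul_zero]
  intro hM
  obtain ⟨N, hN⟩ := hM.exists_right_inv
  apply hug
  rw [← Matrix.vecMul_one u, ← hN, ← Matrix.vecMul_vecMul, hu, Matrix.zero_vecMul]
  rfl

end Degenerate

theorem mainTheorem11 {F G A : Type*} [Field F] [IsAlgClosed F] [CharZero F]
    [Group G] [Fintype G] [DecidableEq G]
    [NonUnitalRing A] [Module F A] [IsScalarTower F A A] [SMulCommClass F A A]
    (𝒜 : G → Submodule F A) (θ : ScalarFamily G F)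
    (hreg : IsRegularGrading 𝒜 θ) (hdeg : ¬ θ.Nondegenerate) :
    (∃ α : TwoCocycle G F, α.CorrespondsTo θ) ∧
      ∀ α : TwoCocycle G F, α.CorrespondsTo θ → ¬ IsUnit (commutationMatrix α θ) :=
  ⟨hreg.exists_correspondsTo, fun _ hα => hreg.not_isUnit_commutationMatrix hdeg hα⟩
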